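/- Let $n\ge 1$ and let $H_{n,+,1}$ denote the set of density matrices, i.e. positive semidefinite matrices in $\mathbb C^{n\times n}$ of trace $1$. Let $Q:\mathbb C^{n\times n}\to\mathbb C^{n\times n}$, $Q(X)=\sum_{i=1}^k A_iXA_i^*$, be a quantum channel, i.e. $A_1,\dots,A_k\in\mathbb C^{n\times n}$ and $\sum_{i=1}^k A_i^*A_i=I_n$, and suppose that $Q$ is positive, i.e. $Q(X)$ is positive definite for every $X\in H_{n,+,1}$. Let $Q'(X)=\sum_{i=1}^k A_i^*XA_i$ be its dual and put $$\tilde Q(X)=\frac{1}{\operatorname{tr}Q'(X)}\,Q'(X)\quad (X\in H_{n,+,1}).$$ For $\alpha\in H_{n,+,1}$ and positive definite $X$ put $$D_\alpha(X)=\frac{1}{\operatorname{tr}(X^{-1}\alpha)}\,X^{-1/2}\alpha X^{-1/2}.$$ Let $\alpha,\beta\in H_{n,+,1}$. Then $\Phi_{\alpha,\beta}=D_\alpha\circ\tilde Q\circ D_\beta\circ Q$ is a continuous map of $H_{n,+,1}$ into itself, and it has a fixed point in $H_{n,+,1}$. If $\alpha$ is positive definite, then every fixed point of $\Phi_{\alpha,\beta}$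 in $H_{n,+,1}$ is positive definite. -/

import Mathlib

open scoped Matrix MatrixOrder ComplexOrder

noncomputable section

namespace QuantumScaling

/-- The density matrices: positive semidefinite complex `n × n` matrices of trace `1`. -/
def densityMatrices (n : ℕ) : Set (Matrix (Fin n) (Fin n) ℂ) :=
  {X | X.PosSemidef ∧ X.trace = 1}

/-- The completely positive operator `Q(X) = ∑ i, A i * X * (A i)ᴴ` given by `A 0, …, A (k - 1)`. -/
def cpMap {n k : ℕ} (A : Fin k → Matrix (Fin n) (Fin n) ℂ) (X : Matrix (Fin n) (Fin n) ℂ) :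
    Matrix (Fin n) (Fin n) ℂ :=
  ∑ i, A i * X * (A i)ᴴ

/-- The dual operator `Q'(X) = ∑ i, (A i)ᴴ * X * A i`, for the inner product `tr (X * Yᴴ)`. -/
def dualMap {n k : ℕ} (A : Fin k → Matrix (Fin n) (Fin n) ℂ) (X : Matrix (Fin n) (Fin n) ℂ) :
    Matrix (Fin n) (Fin n) ℂ :=
  ∑ i, (A i)ᴴ * X * A i

/-- The completely positive operator given by `A` is a quantum channel (it preserves the trace). -/
def IsQuantumChannel {n k : ℕ} (A : Fin k → Matrix (Fin n) (Fin n) ℂ) : Prop :=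
  ∑ i, (A i)ᴴ * A i = 1

/-- The completely positive operator given by `A` is positive: it maps every density matrix to
a positive definite matrix. -/
def IsPositive {n k : ℕ} (A : Fin k → Matrix (Fin n) (Fin n) ℂ) : Prop :=
  ∀ X ∈ densityMatrices n, (cpMap A X).PosDef

/-- The normalized dual `X ↦ Q'(X) / tr Q'(X)`; meant for density matrices `X`. -/
def normalizedDual {n k : ℕ} (A : Fin k → Matrix (Fin n) (Fin n) ℂ)
    (X : Matrix (Fin n) (Fin n) ℂ) : Matrix (Fin n) (Fin n) ℂ :=
  (1 / (dualMap A X).trace) • dualMap A X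

/-- `D_α(X) = X^{-1/2} α X^{-1/2} / tr (X⁻¹ α)`; meant for positive definite `X`.
Here `CFC.sqrt X` is the positive semidefinite square root of `X`. -/
def scalingMap {n : ℕ} (α X : Matrix (Fin n) (Fin n) ℂ) : Matrix (Fin n) (Fin n) ℂ :=
  (1 / (X⁻¹ * α).trace) • ((CFC.sqrt X)⁻¹ * α * (CFC.sqrt X)⁻¹)

/-- `Φ_{α,β} = D_α ∘ Q̃ ∘ D_β ∘ Q`, where `Q̃` is the normalized dual of `Q`. -/
def bridgeMap {n k : ℕ} (A : Fin k → Matrix (Fin n) (Fin n) ℂ)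
    (α β : Matrix (Fin n) (Fin n) ℂ) :
    Matrix (Fin n) (Fin n) ℂ → Matrix (Fin n) (Fin n) ℂ :=
  scalingMap α ∘ normalizedDual A ∘ scalingMap β ∘ cpMap A

end QuantumScaling

end

/-! The density matrices form a compact convex set, so Brouwer's theorem
(`Convex.exists_fixedPoint`) yields a fixed point once Φ is a continuous self-map. The issue is
invertibility: Q has positive definite values by hypothesis, and so does its dual, since v*Q'(X)v =
tr(X Q(vv*)) > 0 (`QuantumScaling.IsPositive.dualMap_posDef`). D_α(Y) is a normalized congruence of
α, hence positive definite when α is; a fixed point of Φ is such a value.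

Brouwer's theorem is proved by the Milnor–Rogers volume argument. If x + g(x) were a C¹ retraction
of a ball onto its sphere, ∫ det(1 + t Dg) would be a polynomial in t, equal to the volume of the
ball for small t > 0 but to 0 at t = 1. A C¹ self-map of the ball without fixed points would give
such a retraction; approximation and metric projection pass to continuous maps of compact convex
sets. -/

open MeasureTheory Metric Set Module
open scoped NNReal RealInnerProductSpace

/-! ### Brouwer's fixed point theorem -/

section Brouwer

/-- The value at `1` of `t ↦ det (1 + t • M)` is a fixed affine combination of its values at
`finrank + 1` distinct nodes, independent of `M`. -/
theorem LinearMap.det_one_add_eq_sum_nodes {E : Type*} [AddCommGroup E] [Module ℝ E]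
    [FiniteDimensional ℝ E] (v : Fin (finrank ℝ E + 1) → ℝ) (hv : Function.Injective v) :
    ∃ c : Fin (finrank ℝ E + 1) → ℝ, ∑ j, c j = 1 ∧
      ∀ M : E →ₗ[ℝ] E, LinearMap.det (1 + M) = ∑ j, c j * LinearMap.det (1 + v j • M) := by
  classical
  -- Lagrange interpolation at the nodes; it applies because det (1 + t M) has degree at most
  -- `finrank ℝ E` in t.
  have key : ∀ p : Polynomial ℝ, p.degree < (finrank ℝ E + 1 : ℕ) →
      p.eval 1 = ∑ j, (Lagrange.basis Finset.univ v j).eval 1 * p.eval (v j) := by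
    intro p hp
    have h := Lagrange.eq_interpolate (s := Finset.univ) (v := v) (f := p) hv.injOn (by simpa using hp)
    conv_lhs => rw [h]
    simp [Lagrange.interpolate_apply, Polynomial.eval_finsetSum, mul_comm]
  refine ⟨fun j => (Lagrange.basis Finset.univ v j).eval 1, ?_, fun M => ?_⟩
  · have := key 1 (by
      rw [Polynomial.degree_one]
      exact_mod_cast Nat.succ_pos _)
    simpa using this.symm
  · let b := finBasis ℝ E
    let A := LinearMap.toMatrix b b M
    let P : Matrix (Fin (finrank ℝ E)) (Fin (finrank ℝ E)) (Polynomial ℝ) :=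
      (Polynomial.X : Polynomial ℝ) • A.map Polynomial.C + (1 : Matrix _ _ ℝ).map Polynomial.C
    have hdeg : P.det.degree < (finrank ℝ E + 1 : ℕ) := by
      refine lt_of_le_of_lt Polynomial.degree_le_natDegree ?_
      have := Polynomial.natDegree_det_X_add_C_le A 1
      simp only [Fintype.card_fin] at this
      exact_mod_cast Nat.lt_succ_of_le this
    have hev : ∀ t : ℝ, P.det.eval t = LinearMap.det (1 + t • M) := by
      intro t
      rw [← LinearMap.det_toMatrix b, ← Polynomial.coe_evalRingHom, RingHom.map_det]
      congr 1
      ext i j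
      simp [P, A, Matrix.one_apply, add_comm, LinearMap.toMatrix_one]
      split_ifs <;> simp [mul_comm]
    have := key P.det hdeg
    simp only [hev, one_smul] at this
    exact this

/-- The metric projection onto a nonempty complete convex set is a Lipschitz retraction. -/
theorem exists_lipschitz_retraction {E : Type*} [NormedAddCommGroup E] [InnerProductSpace ℝ E]
    {K : Set E} (hne : K.Nonempty) (hK : IsComplete K) (hc : Convex ℝ K) :
    ∃ p : E → E, LipschitzWith 1 p ∧ (∀ x, p x ∈ K) ∧ ∀ x ∈ K, p x = x := by
  choose p hpK hp using exists_norm_eq_iInf_of_complete_convex hne hK hc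
  have hp' : ∀ u, ∀ w ∈ K, ⟪u - p u, w - p u⟫ ≤ 0 := fun u =>
    (norm_eq_iInf_iff_real_inner_le_zero hc (hpK u)).1 (hp u)
  refine ⟨p, LipschitzWith.of_dist_le_mul fun x y => ?_, hpK, fun x hx => ?_⟩
  · have h1 := hp' x _ (hpK y)
    have h2 := hp' y _ (hpK x)
    -- Sum of the two obtuse-angle inequalities `h1` and `h2`.
    have h3 : ⟪p x - p y, p x - p y⟫ ≤ ⟪x - y, p x - p y⟫ := by
      have e : ⟪x - y, p x - p y⟫ - ⟪p x - p y, p x - p y⟫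
          = - ⟪x - p x, p y - p x⟫ - ⟪y - p y, p x - p y⟫ := by
        simp only [inner_sub_left, inner_sub_right]; ring
      linarith
    have h4 := real_inner_le_norm (x - y) (p x - p y)
    rw [real_inner_self_eq_norm_mul_norm] at h3
    simp only [dist_eq_norm, NNReal.coe_one, one_mul]
    by_contra hlt
    push Not at hlt
    have : 0 < ‖p x - p y‖ := lt_of_le_of_lt (norm_nonneg _) hlt
    nlinarith
  · have h := hp' x x hx
    rw [real_inner_self_eq_norm_sq] at h
    have : ‖x - p x‖ = 0 := by nlinarith [norm_nonneg (x - p x)]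
    exact (sub_eq_zero.1 (norm_eq_zero.1 this)).symm

/-- If `id + g` maps a closed ball into itself and fixes its boundary, then `id + t • g` is a
bijection of the open ball for small `t > 0`, so its Jacobian integrates to the volume. -/
theorem integral_det_one_add_smul_of_fixes_sphere {E : Type*} [NormedAddCommGroup E]
    [InnerProductSpace ℝ E] [FiniteDimensional ℝ E] [Nontrivial E] [MeasurableSpace E]
    [BorelSpace E] (μ : Measure E) [μ.IsAddHaarMeasure] {R : ℝ} (hR : 0 < R) {g : E → E}
    (hg : ∀ x ∈ closedBall (0 : E) R, ContDiffAt ℝ 1 g x)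
    (hmaps : ∀ x ∈ closedBall (0 : E) R, ‖x + g x‖ ≤ R)
    (hfix : ∀ x ∈ sphere (0 : E) R, g x = 0) :
    ∃ ε > 0, ∀ t ∈ Ioo (0 : ℝ) ε,
      ∫ x in ball (0 : E) R, (1 + t • fderiv ℝ g x).det ∂μ = μ.real (ball (0 : E) R) := by
  have hcont : ContinuousOn (fderiv ℝ g) (closedBall (0 : E) R) := fun x hx =>
    ((hg x hx).fderiv_right (m := 0) (by norm_num)).continuousAt.continuousWithinAt
  obtain ⟨C, hC⟩ := (isCompact_closedBall (0 : E) R).exists_bound_of_continuousOn hcont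
  have hC0 : 0 ≤ C := (norm_nonneg _).trans (hC 0 (by simp [hR.le]))
  lift C to ℝ≥0 using hC0
  have hdiff : ∀ x ∈ closedBall (0 : E) R, DifferentiableAt ℝ g x := fun x hx =>
    (hg x hx).differentiableAt (by norm_num)
  have hlip : LipschitzOnWith C g (closedBall (0 : E) R) :=
    (convex_closedBall (0 : E) R).lipschitzOnWith_of_nnnorm_fderiv_le hdiff hC
  obtain ⟨δ, hδ, hdet⟩ : ∃ δ > 0, ∀ A : E →L[ℝ] E, ‖A‖ < δ → 0 < (1 + A).det := by
    have h : Continuous fun A : E →L[ℝ] E => (1 + A).det :=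
      ContinuousLinearMap.continuous_det.comp (continuous_const.add continuous_id)
    have h0 : (0 : ℝ) < (1 + (0 : E →L[ℝ] E)).det := by
      simp [ContinuousLinearMap.det]
    obtain ⟨δ, hδ, H⟩ := Metric.eventually_nhds_iff.1 (h.continuousAt.eventually_const_lt h0)
    exact ⟨δ, hδ, fun A hA => H (by simpa using hA)⟩
  -- The three bounds serve convexity (t < 1), injectivity and openness (tC < 1), and positivity of
  -- the Jacobian (tC < δ).
  refine ⟨min 1 (min (1 / (C + 1)) (δ / (C + 1))), by positivity, fun t ht => ?_⟩
  obtain ⟨ht0, ht1⟩ := ht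
  simp only [lt_min_iff] at ht1
  obtain ⟨ht1, ht2, ht3⟩ := ht1
  have hC1 : (0 : ℝ) < C + 1 := by positivity
  rw [lt_div_iff₀ hC1] at ht2 ht3
  let F : E → E := fun x => x + t • g x
  have happ : ApproximatesLinearOn F ((ContinuousLinearEquiv.refl ℝ E : E ≃L[ℝ] E) : E →L[ℝ] E)
      (closedBall (0 : E) R) (t.toNNReal * C) := by
    intro x hx y hy
    have h := hlip.norm_sub_le hx hy
    have e : F x - F y - ((ContinuousLinearEquiv.refl ℝ E : E ≃L[ℝ] E) : E →L[ℝ] E) (x - y)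
        = t • (g x - g y) := by
      simp only [F, ContinuousLinearEquiv.coe_refl, ContinuousLinearMap.coe_id', id, smul_sub]
      abel
    rw [e, norm_smul, Real.norm_of_nonneg ht0.le, NNReal.coe_mul, Real.coe_toNNReal _ ht0.le,
      mul_assoc]
    gcongr
  have hsmall : t.toNNReal * C < 1 := by
    rw [← NNReal.coe_lt_coe, NNReal.coe_mul, Real.coe_toNNReal _ ht0.le, NNReal.coe_one]
    nlinarith
  have hnorm : ‖((ContinuousLinearEquiv.refl ℝ E).symm : E →L[ℝ] E)‖₊ = 1 := by
    rw [← NNReal.coe_inj, coe_nnnorm]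
    simp
  have hinj : InjOn F (closedBall (0 : E) R) :=
    happ.injOn (Or.inr (by rw [hnorm, inv_one]; exact hsmall))
  have hopen : IsOpen (F '' ball (0 : E) R) :=
    (happ.mono_set ball_subset_closedBall).open_image
      (ContinuousLinearEquiv.toNonlinearRightInverse _) isOpen_ball
      (Or.inr (by
        change _ < (‖((ContinuousLinearEquiv.refl ℝ E).symm : E →L[ℝ] E)‖₊)⁻¹
        rw [hnorm, inv_one]; exact hsmall))
  have hclosed : IsClosed (F '' closedBall (0 : E) R) :=
    ((isCompact_closedBall (0 : E) R).image_of_continuousOn happ.continuousOn).isClosed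
  have hsub : F '' ball (0 : E) R ⊆ ball 0 R := by
    rintro _ ⟨x, hx, rfl⟩
    have hx' := hmaps x (ball_subset_closedBall hx)
    rw [mem_ball_zero_iff] at hx ⊢
    have e : F x = (1 - t) • x + t • (x + g x) := by
      simp only [F, smul_add, sub_smul, one_smul]; abel
    calc ‖F x‖ ≤ (1 - t) * ‖x‖ + t * ‖x + g x‖ := by
          rw [e]
          refine (norm_add_le _ _).trans ?_
          rw [norm_smul, norm_smul, Real.norm_of_nonneg ht0.le,
            Real.norm_of_nonneg (sub_nonneg.2 ht1.le)]
      _ < R := by nlinarith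
  -- The image of the open ball is open, and closed relative to the ball because `F` fixes the
  -- sphere; connectedness does the rest.
  have himage : F '' ball (0 : E) R = ball 0 R := by
    refine hsub.antisymm ?_
    have hpre : IsPreconnected (ball (0 : E) R) := (convex_ball (0 : E) R).isPreconnected
    refine hpre.subset_left_of_subset_union hopen hclosed.isOpen_compl ?_ ?_ ?_
    · exact disjoint_compl_right_iff_subset.2 (image_mono ball_subset_closedBall)
    · intro y hy
      by_cases h : y ∈ F '' closedBall (0 : E) R
      · obtain ⟨x, hx, rfl⟩ := h
        refine Or.inl ⟨x, ?_, rfl⟩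
        by_contra hxb
        have hxs : x ∈ sphere (0 : E) R := by
          rw [mem_sphere]; exact le_antisymm hx (not_lt.1 hxb)
        have : F x = x := by simp [F, hfix x hxs]
        rw [this] at hy
        exact hxb hy
      · exact Or.inr h
    · have h0 : F 0 ∈ F '' ball (0 : E) R := mem_image_of_mem _ (mem_ball_self hR)
      exact ⟨F 0, hsub h0, h0⟩
  have hFderiv : ∀ x ∈ ball (0 : E) R,
      HasFDerivWithinAt F (1 + t • fderiv ℝ g x) (ball (0 : E) R) x := fun x hx =>
    ((hasFDerivAt_id x).add
      ((hdiff x (ball_subset_closedBall hx)).hasFDerivAt.const_smul t)).hasFDerivWithinAt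
  have hpos : ∀ x ∈ ball (0 : E) R, 0 < (1 + t • fderiv ℝ g x).det := fun x hx => by
    refine hdet _ ?_
    rw [norm_smul, Real.norm_of_nonneg ht0.le]
    have := hC x (ball_subset_closedBall hx)
    nlinarith
  have hvol := integral_image_eq_integral_abs_det_fderiv_smul μ measurableSet_ball hFderiv
    (hinj.mono ball_subset_closedBall) (fun _ => (1 : ℝ))
  rw [himage] at hvol
  simp only [integral_const, MeasurableSet.univ, measureReal_restrict_apply, univ_inter, smul_eq_mul,
    mul_one] at hvol
  rw [hvol]
  exact setIntegral_congr_fun measurableSet_ball fun x hx => (abs_of_pos (hpos x hx)).symm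

/-- There is no `C¹` retraction of a closed ball onto its boundary sphere. -/
theorem not_exists_contDiff_retraction_sphere {E : Type*} [NormedAddCommGroup E]
    [InnerProductSpace ℝ E] [FiniteDimensional ℝ E] {R : ℝ} (hR : 0 < R) {f : E → E}
    (hf : ∀ x ∈ closedBall (0 : E) R, ContDiffAt ℝ 1 f x)
    (hmaps : ∀ x ∈ closedBall (0 : E) R, ‖f x‖ = R)
    (hfix : ∀ x ∈ sphere (0 : E) R, f x = x) : False := by
  have : Nontrivial E := ⟨f 0, 0, fun h => by
    have := hmaps 0 (by simp [hR.le]); rw [h, norm_zero] at this; exact hR.ne this⟩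
  borelize E
  let μ : Measure E := Measure.addHaar
  let g : E → E := fun x => f x - x
  have hg : ∀ x ∈ closedBall (0 : E) R, ContDiffAt ℝ 1 g x := fun x hx =>
    (hf x hx).sub contDiffAt_id
  obtain ⟨ε, hε, H⟩ := integral_det_one_add_smul_of_fixes_sphere μ hR hg
    (fun x hx => by simp [g, hmaps x hx]) (fun x hx => by simp [g, hfix x hx])
  have hcont : ContinuousOn (fderiv ℝ g) (closedBall (0 : E) R) := fun x hx =>
    ((hg x hx).fderiv_right (m := 0) (by norm_num)).continuousAt.continuousWithinAt
  have hint : ∀ t : ℝ, IntegrableOn (fun x => (1 + t • fderiv ℝ g x).det) (ball (0 : E) R) μ :=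
    fun t => ((ContinuousLinearMap.continuous_det.comp_continuousOn
      (continuousOn_const.add (hcont.const_smul t))).integrableOn_compact
        (isCompact_closedBall _ _)).mono_set ball_subset_closedBall
  let d := finrank ℝ E
  -- Distinct nodes inside (0, ε), where the integral is known to be the volume.
  let v : Fin (d + 1) → ℝ := fun j => ε * (((j : ℕ) + 1) / (d + 2))
  have hv : Function.Injective v := by
    intro i j hij
    have hd : (0 : ℝ) < d + 2 := by positivity
    have := mul_left_cancel₀ hε.ne' hij
    rw [div_left_inj' hd.ne'] at this
    exact Fin.ext (by exact_mod_cast add_right_cancel this)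
  have hvm : ∀ j, v j ∈ Ioo (0 : ℝ) ε := by
    intro j
    have hj : ((j : ℕ) : ℝ) + 1 < d + 2 := by
      have : (j : ℕ) + 1 < d + 2 := by omega
      exact_mod_cast this
    refine ⟨by positivity, ?_⟩
    have : (((j : ℕ) : ℝ) + 1) / (d + 2) < 1 := (div_lt_one (by positivity)).2 hj
    simpa [v] using mul_lt_mul_of_pos_left this hε
  obtain ⟨c, hc1, hc⟩ := LinearMap.det_one_add_eq_sum_nodes v hv
  have hone : ∫ x in ball (0 : E) R, (1 + fderiv ℝ g x).det ∂μ = μ.real (ball (0 : E) R) := by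
    calc ∫ x in ball (0 : E) R, (1 + fderiv ℝ g x).det ∂μ
        = ∫ x in ball (0 : E) R, ∑ j, c j * (1 + v j • fderiv ℝ g x).det ∂μ :=
          integral_congr_ae (Filter.Eventually.of_forall fun x => hc (fderiv ℝ g x))
      _ = ∑ j, c j * μ.real (ball (0 : E) R) := by
          rw [integral_finsetSum _ fun j _ => (hint (v j)).const_mul (c j)]
          exact Finset.sum_congr rfl fun j _ => by rw [integral_const_mul, H _ (hvm j)]
      _ = μ.real (ball (0 : E) R) := by rw [← Finset.sum_mul, hc1, one_mul]
  have hzero : ∫ x in ball (0 : E) R, (1 + fderiv ℝ g x).det ∂μ = 0 := by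
    rw [setIntegral_congr_fun (g := fun _ => (0 : ℝ)) measurableSet_ball fun x hx => ?_]
    · simp
    have hx' := ball_subset_closedBall hx
    have hfd : HasFDerivAt f (fderiv ℝ f x) x :=
      ((hf x hx').differentiableAt (by norm_num)).hasFDerivAt
    have e : 1 + fderiv ℝ g x = fderiv ℝ f x := by
      have : HasFDerivAt g (fderiv ℝ f x - 1) x := hfd.sub (hasFDerivAt_id x)
      rw [this.fderiv]; abel
    -- Differentiating ‖f‖² = R² puts the range of the derivative in the orthogonal complement of `f
    -- x`, so its determinant vanishes.
    have horth : ∀ w, ⟪f x, fderiv ℝ f x w⟫ = 0 := by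
      intro w
      have h1 := hfd.inner ℝ hfd
      have h2 : HasFDerivAt (fun y => ⟪f y, f y⟫) (0 : E →L[ℝ] ℝ) x := by
        refine (hasFDerivAt_const (R * R) x).congr_of_eventuallyEq ?_
        filter_upwards [isOpen_ball.mem_nhds hx] with y hy
        rw [real_inner_self_eq_norm_mul_norm, hmaps y (ball_subset_closedBall hy)]
      have h3 := congrArg (fun L : E →L[ℝ] ℝ => L w) (h1.unique h2)
      simp only [ContinuousLinearMap.comp_apply, ContinuousLinearMap.prod_apply,
        fderivInnerCLM_apply, _root_.zero_apply] at h3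
      rw [real_inner_comm (f x)] at h3
      rw [real_inner_comm] at h3 ⊢
      linarith
    change (1 + fderiv ℝ g x).det = 0
    rw [e]
    by_contra hne
    obtain ⟨w, hw⟩ := (LinearMap.equivOfDetNeZero _ hne).surjective (f x)
    have hw' : fderiv ℝ f x w = f x := hw
    have := horth w
    rw [hw', real_inner_self_eq_norm_mul_norm, hmaps x hx'] at this
    nlinarith
  rw [hone] at hzero
  exact (ENNReal.toReal_pos (measure_ball_pos μ 0 hR).ne' measure_ball_lt_top.ne).ne' hzero

/-- Without a fixed point, following the ray from `h x` through `x` to the sphere is a C¹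
retraction. The parameter `s` is the larger root of a s² + 2 b s + ‖x‖² - R² = 0. -/
theorem ContDiff.exists_fixedPoint_closedBall {E : Type*} [NormedAddCommGroup E]
    [InnerProductSpace ℝ E] [FiniteDimensional ℝ E] {R : ℝ} (hR : 0 < R) {h : E → E}
    (hh : ContDiff ℝ 1 h) (hmaps : MapsTo h (closedBall 0 R) (closedBall 0 R)) :
    ∃ x ∈ closedBall (0 : E) R, h x = x := by
  by_contra! hne
  let u : E → E := fun x => x - h x
  let a : E → ℝ := fun x => ⟪u x, u x⟫
  let b : E → ℝ := fun x => ⟪x, u x⟫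
  let D : E → ℝ := fun x => b x ^ 2 + a x * (R ^ 2 - ⟪x, x⟫)
  let s : E → ℝ := fun x => (-b x + √(D x)) / a x
  have hu : ContDiff ℝ 1 u := contDiff_id.sub hh
  have ha : ContDiff ℝ 1 a := hu.inner ℝ hu
  have hb : ContDiff ℝ 1 b := contDiff_id.inner ℝ hu
  have hD : ContDiff ℝ 1 D :=
    (hb.pow 2).add (ha.mul (contDiff_const.sub (contDiff_id.inner ℝ contDiff_id)))
  have hapos : ∀ x ∈ closedBall (0 : E) R, 0 < a x := fun x hx =>
    real_inner_self_pos.2 (sub_ne_zero.2 (hne x hx).symm)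
  -- On the sphere 2b - a = ‖x‖² - ‖h x‖² ≥ 0. Positivity of `b` makes `s` vanish there and keeps
  -- `D` positive.
  have hbpos : ∀ x ∈ sphere (0 : E) R, 0 < b x := by
    intro x hx
    have hx' := sphere_subset_closedBall hx
    have h1 : a x = ⟪x, x⟫ - 2 * ⟪x, h x⟫ + ⟪h x, h x⟫ := by
      simp only [a, u]; exact real_inner_sub_sub_self x (h x)
    have h2 : b x = ⟪x, x⟫ - ⟪x, h x⟫ := inner_sub_right _ _ _
    have h3 : ⟪x, x⟫ = R ^ 2 := by
      rw [real_inner_self_eq_norm_sq, mem_sphere_zero_iff_norm.1 hx]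
    have h4 : ⟪h x, h x⟫ ≤ R ^ 2 := by
      rw [real_inner_self_eq_norm_sq]
      have := mem_closedBall_zero_iff.1 (hmaps hx')
      gcongr
    have := hapos x hx'
    linarith
  have hDpos : ∀ x ∈ closedBall (0 : E) R, 0 < D x := by
    intro x hx
    have hax := hapos x hx
    rcases (mem_closedBall_zero_iff.1 hx).lt_or_eq with hlt | heq
    · have : 0 < R ^ 2 - ⟪x, x⟫ := by
        rw [real_inner_self_eq_norm_sq, sub_pos]
        gcongr
      positivity
    · have hbx := hbpos x (mem_sphere_zero_iff_norm.2 heq)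
      have : R ^ 2 - ⟪x, x⟫ = 0 := by rw [real_inner_self_eq_norm_sq, heq, sub_self]
      simp only [D, this, mul_zero, add_zero]
      positivity
  refine not_exists_contDiff_retraction_sphere hR (f := fun x => x + s x • u x) ?_ ?_ ?_
  · intro x hx
    exact contDiffAt_id.add ((((hb.neg.contDiffAt).add
      (hD.contDiffAt.sqrt (hDpos x hx).ne')).div ha.contDiffAt (hapos x hx).ne').smul
        hu.contDiffAt)
  · intro x hx
    have hax := (hapos x hx).ne'
    have hs : a x * s x + b x = √(D x) := by simp only [s]; field_simp; ring
    have hs2 : (a x * s x + b x) ^ 2 = D x := by rw [hs, Real.sq_sqrt (hDpos x hx).le]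
    have e1 : ‖x + s x • u x‖ ^ 2 = ⟪x, x⟫ + 2 * (s x * b x) + s x ^ 2 * a x := by
      rw [← real_inner_self_eq_norm_sq, real_inner_add_add_self, real_inner_smul_right,
        real_inner_smul_left, real_inner_smul_right]
      ring
    have e2 : ‖x + s x • u x‖ ^ 2 = R ^ 2 := by
      rw [e1]
      apply mul_left_cancel₀ hax
      simp only [D] at hs2
      linarith
    exact (sq_eq_sq₀ (norm_nonneg _) hR.le).1 e2
  · intro x hx
    have hbx := hbpos x hx
    have : R ^ 2 - ⟪x, x⟫ = 0 := by
      rw [real_inner_self_eq_norm_sq, mem_sphere_zero_iff_norm.1 hx, sub_self]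
    have : s x = 0 := by
      simp only [s, D, this, mul_zero, add_zero, Real.sqrt_sq hbx.le, neg_add_cancel, zero_div]
    simp [this]

/-- With `p` the retraction onto `K`, a fixed point of `f ∘ p` lies in `K`, hence is fixed by `f`.
If there were none in a large ball, the displacement would be bounded below there, contradicting a
close smooth approximation. -/
theorem Convex.exists_fixedPoint_of_innerProductSpace {E : Type*} [NormedAddCommGroup E]
    [InnerProductSpace ℝ E] [FiniteDimensional ℝ E] {K : Set E} (hK : IsCompact K)
    (hc : Convex ℝ K) (hne : K.Nonempty) {f : E → E} (hf : ContinuousOn f K)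
    (hmaps : MapsTo f K K) : ∃ x ∈ K, f x = x := by
  obtain ⟨p, hp, hpK, hpid⟩ := exists_lipschitz_retraction hne hK.isComplete hc
  have hunif : UniformContinuous (f ∘ p) :=
    uniformContinuousOn_univ.1 ((hK.uniformContinuousOn_of_continuous hf).comp
      hp.uniformContinuous.uniformContinuousOn fun x _ => hpK x)
  obtain ⟨r, hr⟩ := hK.isBounded.subset_closedBall (0 : E)
  -- The extra 1 absorbs the approximation error, so that `h` preserves the ball.
  let R : ℝ := max r 0 + 1
  have hR : 0 < R := by positivity
  suffices ∃ x ∈ closedBall (0 : E) R, f (p x) = x by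
    obtain ⟨x, -, hx⟩ := this
    have hxK : x ∈ K := hx ▸ hmaps (hpK x)
    exact ⟨x, hxK, by rwa [hpid x hxK] at hx⟩
  by_contra! hno
  have hcompact := isCompact_closedBall (0 : E) R
  obtain ⟨x₀, hx₀, hmin⟩ := hcompact.exists_isMinOn ⟨0, by simp [hR.le]⟩
    (hunif.continuous.dist continuous_id).continuousOn
  have hδ : 0 < dist (f (p x₀)) x₀ := dist_pos.2 (hno x₀ hx₀)
  obtain ⟨h, hh, happ⟩ := hunif.exists_contDiff_dist_le (lt_min hδ one_pos)
  have hball : MapsTo h (closedBall 0 R) (closedBall 0 R) := by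
    intro x _
    have h1 := (happ x).le.trans (min_le_right _ _)
    have h2 : dist (f (p x)) 0 ≤ r := hr (hmaps (hpK x))
    have := dist_triangle (h x) (f (p x)) 0
    have h3 := le_max_left r 0
    simp only [Function.comp] at h1
    rw [mem_closedBall]
    linarith
  obtain ⟨x, hx, hfix⟩ := ContDiff.exists_fixedPoint_closedBall hR (hh.of_le (by norm_cast)) hball
  have h1 := (happ x).trans_le (min_le_left _ _)
  rw [hfix, dist_comm] at h1
  exact absurd h1 (not_lt.2 (hmin hx))

/-- **Brouwer's fixed point theorem**: a continuous self-map of a nonempty compact convex subset of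
a finite-dimensional real vector space has a fixed point. -/
theorem Convex.exists_fixedPoint {E : Type*} [AddCommGroup E] [TopologicalSpace E]
    [IsTopologicalAddGroup E] [T2Space E] [Module ℝ E] [ContinuousSMul ℝ E]
    [FiniteDimensional ℝ E] {K : Set E} (hc : Convex ℝ K) (hK : IsCompact K)
    (hne : K.Nonempty) {f : E → E} (hf : ContinuousOn f K)
    (hmaps : MapsTo f K K) : ∃ x ∈ K, f x = x := by
  let e : E ≃L[ℝ] EuclideanSpace ℝ (Fin (finrank ℝ E)) := toEuclidean
  obtain ⟨y, ⟨x, hx, rfl⟩, hy⟩ := Convex.exists_fixedPoint_of_innerProductSpace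
    (K := e '' K) (f := fun y => e (f (e.symm y))) (hK.image e.continuous)
    (hc.linear_image e.toLinearEquiv.toLinearMap) (hne.image e)
    (e.continuous.comp_continuousOn (hf.comp e.symm.continuous.continuousOn (by
      rintro _ ⟨x, hx, rfl⟩; simpa using hx)))
    (by rintro _ ⟨x, hx, rfl⟩; exact ⟨f x, hmaps hx, by simp⟩)
  exact ⟨x, hx, e.injective (by simpa using hy)⟩

end Brouwer

/-! ### Positive definite matrices: square roots, traces, continuity -/

namespace Matrix

variable {m : Type*} [Fintype m]

theorem PosSemidef.trace_pos_of_ne_zero {X : Matrix m m ℂ} (hX : X.PosSemidef) (h0 : X ≠ 0) :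
    0 < X.trace :=
  lt_of_le_of_ne hX.trace_nonneg fun h => h0 (hX.trace_eq_zero_iff.1 h.symm)

theorem PosSemidef.mul_mul_self_of_isHermitian {X S : Matrix m m ℂ} (hX : X.PosSemidef)
    (hS : S.IsHermitian) : (S * X * S).PosSemidef := by
  have := hX.mul_mul_conjTranspose_same S
  rwa [hS.eq] at this

variable [DecidableEq m]

theorem PosDef.sqrt_posDef {Y : Matrix m m ℂ} (hY : Y.PosDef) : (CFC.sqrt Y).PosDef :=
  isStrictlyPositive_iff_posDef.1
    (IsStrictlyPositive.sqrt Y (isStrictlyPositive_iff_posDef.2 hY))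

theorem PosDef.inv_sqrt_mul_inv_sqrt {Y : Matrix m m ℂ} (hY : Y.PosDef) :
    (CFC.sqrt Y)⁻¹ * (CFC.sqrt Y)⁻¹ = Y⁻¹ := by
  rw [← Matrix.mul_inv_rev, CFC.sqrt_mul_sqrt_self Y hY.posSemidef.nonneg]

theorem mul_mul_self_ne_zero {X S : Matrix m m ℂ} (hS : IsUnit S) (h0 : X ≠ 0) :
    S * X * S ≠ 0 := by
  intro h
  exact h0 ((hS.mul_right_eq_zero).1 ((hS.mul_left_eq_zero).1 h))

/-- By cyclicity the trace is that of the congruence of `X` by √Y, which is again nonzero and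
positive semidefinite. -/
theorem PosSemidef.trace_mul_pos {X Y : Matrix m m ℂ} (hX : X.PosSemidef) (h0 : X ≠ 0)
    (hY : Y.PosDef) : 0 < (X * Y).trace := by
  have hS := hY.sqrt_posDef
  have e : (X * Y).trace = (CFC.sqrt Y * X * CFC.sqrt Y).trace := by
    conv_lhs => rw [← CFC.sqrt_mul_sqrt_self Y hY.posSemidef.nonneg, ← mul_assoc]
    rw [Matrix.trace_mul_comm, mul_assoc]
  rw [e]
  exact (hX.mul_mul_self_of_isHermitian hS.isHermitian).trace_pos_of_ne_zero
    (mul_mul_self_ne_zero hS.isUnit h0)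

open scoped Matrix.Norms.L2Operator in
theorem continuousOn_sqrt_posSemidef :
    ContinuousOn (CFC.sqrt : Matrix m m ℂ → Matrix m m ℂ) {X | X.PosSemidef} :=
  (CFC.continuousOn_sqrt (A := Matrix m m ℂ)).mono fun _ hX => PosSemidef.nonneg hX

theorem continuousOn_inv_of_isUnit :
    ContinuousOn (fun X : Matrix m m ℂ => X⁻¹) {X | IsUnit X} := fun X hX =>
  (continuousAt_matrix_inv X (by
    have : X.det ≠ 0 := ((Matrix.isUnit_iff_isUnit_det X).1 hX).ne_zero
    simpa only [Ring.inverse_eq_inv'] using continuousAt_inv₀ this)).continuousWithinAt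

end Matrix

/-! ### The maps Q, Q̃ and D_α on density matrices -/

namespace QuantumScaling

open Matrix

variable {n k : ℕ}

theorem ne_zero_of_mem_densityMatrices {X : Matrix (Fin n) (Fin n) ℂ}
    (hX : X ∈ densityMatrices n) : X ≠ 0 := by
  rintro rfl
  simpa using hX.2

theorem inv_trace_smul_mem_densityMatrices {X : Matrix (Fin n) (Fin n) ℂ} (hX : X.PosSemidef)
    (h0 : X ≠ 0) : (1 / X.trace) • X ∈ densityMatrices n := by
  have ht := hX.trace_pos_of_ne_zero h0
  refine ⟨hX.smul (one_div_pos.2 ht).le, ?_⟩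
  rw [trace_smul, smul_eq_mul, one_div_mul_cancel ht.ne']

theorem cpMap_smul (A : Fin k → Matrix (Fin n) (Fin n) ℂ) (c : ℂ)
    (X : Matrix (Fin n) (Fin n) ℂ) : cpMap A (c • X) = c • cpMap A X := by
  simp [cpMap, Finset.smul_sum]

theorem continuous_cpMap (A : Fin k → Matrix (Fin n) (Fin n) ℂ) : Continuous (cpMap A) := by
  unfold cpMap; fun_prop

theorem continuous_dualMap (A : Fin k → Matrix (Fin n) (Fin n) ℂ) : Continuous (dualMap A) := by
  unfold dualMap; fun_prop

/-- Rescaling to trace 1; needed for the unnormalized rank-one matrices vv*. -/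
theorem IsPositive.cpMap_posDef {A : Fin k → Matrix (Fin n) (Fin n) ℂ} (hA : IsPositive A)
    {X : Matrix (Fin n) (Fin n) ℂ} (hX : X.PosSemidef) (h0 : X ≠ 0) : (cpMap A X).PosDef := by
  have ht := hX.trace_pos_of_ne_zero h0
  have h := (hA _ (inv_trace_smul_mem_densityMatrices hX h0)).smul ht
  rwa [← cpMap_smul, smul_smul, mul_one_div_cancel ht.ne', one_smul] at h

theorem trace_dualMap_mul (A : Fin k → Matrix (Fin n) (Fin n) ℂ)
    (X W : Matrix (Fin n) (Fin n) ℂ) :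
    (dualMap A X * W).trace = (X * cpMap A W).trace := by
  simp only [dualMap, cpMap, Finset.sum_mul, Finset.mul_sum, trace_sum]
  refine Finset.sum_congr rfl fun i _ => ?_
  rw [mul_assoc, mul_assoc, Matrix.trace_mul_comm]
  simp only [mul_assoc]

theorem IsPositive.dualMap_posDef {A : Fin k → Matrix (Fin n) (Fin n) ℂ} (hA : IsPositive A)
    {X : Matrix (Fin n) (Fin n) ℂ} (hX : X.PosSemidef) (h0 : X ≠ 0) : (dualMap A X).PosDef := by
  have hpsd : (dualMap A X).PosSemidef :=
    posSemidef_sum _ fun i _ => hX.conjTranspose_mul_mul_same (A i)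
  refine PosDef.of_dotProduct_mulVec_pos hpsd.isHermitian fun v hv => ?_
  have hW : vecMulVec v (star v) ≠ 0 := by
    rw [Ne, vecMulVec_eq_zero]
    simpa using hv
  have e : star v ⬝ᵥ (dualMap A X *ᵥ v) = (dualMap A X * vecMulVec v (star v)).trace := by
    rw [mul_vecMulVec, trace_vecMulVec, dotProduct_comm]
  rw [e, trace_dualMap_mul]
  exact hX.trace_mul_pos h0 (hA.cpMap_posDef (posSemidef_vecMulVec_self_star v) hW)

theorem IsPositive.trace_dualMap_pos {A : Fin k → Matrix (Fin n) (Fin n) ℂ} (hA : IsPositive A)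
    {X : Matrix (Fin n) (Fin n) ℂ} (hX : X ∈ densityMatrices n) : 0 < (dualMap A X).trace := by
  have h0 := ne_zero_of_mem_densityMatrices hX
  -- Excludes n = 0, where a positive definite matrix has trace 0.
  have : Nonempty (Fin n) := not_isEmpty_iff.1 fun _ => h0 (Subsingleton.elim _ _)
  exact (hA.dualMap_posDef hX.1 h0).trace_pos

theorem IsPositive.normalizedDual_posDef {A : Fin k → Matrix (Fin n) (Fin n) ℂ}
    (hA : IsPositive A) {X : Matrix (Fin n) (Fin n) ℂ} (hX : X ∈ densityMatrices n) :
    (normalizedDual A X).PosDef :=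
  (hA.dualMap_posDef hX.1 (ne_zero_of_mem_densityMatrices hX)).smul
    (one_div_pos.2 (hA.trace_dualMap_pos hX))

theorem IsPositive.continuousOn_normalizedDual {A : Fin k → Matrix (Fin n) (Fin n) ℂ}
    (hA : IsPositive A) : ContinuousOn (normalizedDual A) (densityMatrices n) := by
  have hc := (continuous_dualMap A).continuousOn (s := densityMatrices n)
  exact (continuousOn_const.div (continuous_id.matrix_trace.comp_continuousOn hc)
    fun X hX => (hA.trace_dualMap_pos hX).ne').smul hc

/-- Shows that the factor in `scalingMap` normalizes the trace to 1. -/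
theorem trace_inv_mul {Y : Matrix (Fin n) (Fin n) ℂ} (hY : Y.PosDef)
    (β : Matrix (Fin n) (Fin n) ℂ) :
    (Y⁻¹ * β).trace = ((CFC.sqrt Y)⁻¹ * β * (CFC.sqrt Y)⁻¹).trace := by
  rw [← hY.inv_sqrt_mul_inv_sqrt, Matrix.trace_mul_comm _ ((CFC.sqrt Y)⁻¹)]
  simp only [mul_assoc]

theorem trace_inv_mul_pos {β Y : Matrix (Fin n) (Fin n) ℂ} (hβ : β ∈ densityMatrices n)
    (hY : Y.PosDef) : 0 < (Y⁻¹ * β).trace := by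
  rw [Matrix.trace_mul_comm]
  exact hβ.1.trace_mul_pos (ne_zero_of_mem_densityMatrices hβ) hY.inv

theorem scalingMap_mem_densityMatrices {β Y : Matrix (Fin n) (Fin n) ℂ}
    (hβ : β ∈ densityMatrices n) (hY : Y.PosDef) : scalingMap β Y ∈ densityMatrices n := by
  have hS := hY.sqrt_posDef.inv
  rw [scalingMap, trace_inv_mul hY]
  exact inv_trace_smul_mem_densityMatrices (hβ.1.mul_mul_self_of_isHermitian hS.isHermitian)
    (mul_mul_self_ne_zero hS.isUnit (ne_zero_of_mem_densityMatrices hβ))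

theorem scalingMap_posDef {α Y : Matrix (Fin n) (Fin n) ℂ} (hα : α ∈ densityMatrices n)
    (hαpos : α.PosDef) (hY : Y.PosDef) : (scalingMap α Y).PosDef := by
  have hS := hY.sqrt_posDef.inv
  refine PosDef.smul ?_ (one_div_pos.2 (trace_inv_mul_pos hα hY))
  have := (Matrix.IsUnit.posDef_star_right_conjugate_iff hS.isUnit).2 hαpos
  rwa [star_eq_conjTranspose, hS.isHermitian.eq] at this

theorem continuousOn_scalingMap {β : Matrix (Fin n) (Fin n) ℂ} (hβ : β ∈ densityMatrices n) :
    ContinuousOn (scalingMap β) {Y | Y.PosDef} := by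
  have hinv : ContinuousOn (fun Y : Matrix (Fin n) (Fin n) ℂ => Y⁻¹) {Y | Y.PosDef} :=
    continuousOn_inv_of_isUnit.mono fun _ hY => PosDef.isUnit hY
  have hsqrt : ContinuousOn (fun Y : Matrix (Fin n) (Fin n) ℂ => (CFC.sqrt Y)⁻¹)
      {Y | Y.PosDef} :=
    hinv.comp (continuousOn_sqrt_posSemidef.mono fun _ hY => PosDef.posSemidef hY)
      fun _ hY => PosDef.sqrt_posDef hY
  refine (continuousOn_const.div (continuous_id.matrix_trace.comp_continuousOn
    (hinv.mul continuousOn_const)) fun Y hY => (trace_inv_mul_pos hβ hY).ne').smul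
      ((hsqrt.mul continuousOn_const).mul hsqrt)

/-! ### Convexity and compactness of the set of density matrices -/

theorem convex_densityMatrices : Convex ℝ (densityMatrices n) := by
  intro X hX Y hY a b ha hb hab
  refine ⟨(hX.1.smul ha).add (hY.1.smul hb), ?_⟩
  rw [trace_add, trace_smul, trace_smul, hX.2, hY.2, ← add_smul, hab, one_smul]

/-- It is the image of the Frobenius unit sphere `T` under S ↦ S*S, with the square root as
preimage. -/
theorem isCompact_densityMatrices : IsCompact (densityMatrices n) := by
  let T : Set (Matrix (Fin n) (Fin n) ℂ) := {S | (Sᴴ * S).trace = 1}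
  have hT : IsCompact T := by
    have hbox : IsCompact (Set.univ.pi fun _ : Fin n => Set.univ.pi fun _ : Fin n =>
        closedBall (0 : ℂ) 1) :=
      isCompact_univ_pi fun _ => isCompact_univ_pi fun _ => isCompact_closedBall _ _
    refine IsCompact.of_isClosed_subset hbox ?_ ?_
    · exact isClosed_singleton.preimage (f := fun S : Matrix (Fin n) (Fin n) ℂ =>
        (Sᴴ * S).trace) (by fun_prop)
    · intro S hS i _ j _
      have h1 : ∑ j, ∑ i, ‖S i j‖ ^ 2 = 1 := by
        have h : (Sᴴ * S).trace = 1 := hS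
        simp only [trace, diag_apply, mul_apply, conjTranspose_apply, RCLike.star_def,
          Complex.conj_mul'] at h
        exact_mod_cast h
      have h2 : ‖S i j‖ ^ 2 ≤ 1 := by
        rw [← h1]
        exact (Finset.single_le_sum (f := fun i => ‖S i j‖ ^ 2) (fun _ _ => sq_nonneg _)
          (Finset.mem_univ i)).trans (Finset.single_le_sum (f := fun j => ∑ i, ‖S i j‖ ^ 2)
            (fun _ _ => Finset.sum_nonneg fun _ _ => sq_nonneg _) (Finset.mem_univ j))
      rw [mem_closedBall_zero_iff]
      exact (sq_le_one_iff₀ (norm_nonneg _)).1 h2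
  have himage : densityMatrices n = (fun S : Matrix (Fin n) (Fin n) ℂ => Sᴴ * S) '' T := by
    ext X
    constructor
    · rintro ⟨hX, htr⟩
      have hS : (CFC.sqrt X)ᴴ * CFC.sqrt X = X := by
        rw [(CFC.sqrt_nonneg X).posSemidef.isHermitian.eq, CFC.sqrt_mul_sqrt_self X hX.nonneg]
      exact ⟨CFC.sqrt X, by rw [mem_ofPred_eq, hS, htr], hS⟩
    · rintro ⟨S, hS, rfl⟩
      exact ⟨posSemidef_conjTranspose_mul_self S, hS⟩
  rw [himage]
  exact hT.image (by fun_prop)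

end QuantumScaling

theorem theorem4p1 {n k : ℕ} (A : Fin k → Matrix (Fin n) (Fin n) ℂ)
    (hQ : QuantumScaling.IsQuantumChannel A) (hpos : QuantumScaling.IsPositive A)
    (α β : Matrix (Fin n) (Fin n) ℂ)
    (hα : α ∈ QuantumScaling.densityMatrices n) (hβ : β ∈ QuantumScaling.densityMatrices n) :
    Set.MapsTo (QuantumScaling.bridgeMap A α β)
      (QuantumScaling.densityMatrices n) (QuantumScaling.densityMatrices n) ∧
    ContinuousOn (QuantumScaling.bridgeMap A α β) (QuantumScaling.densityMatrices n) ∧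
    (∃ U ∈ QuantumScaling.densityMatrices n, QuantumScaling.bridgeMap A α β U = U) ∧
    (α.PosDef → ∀ U ∈ QuantumScaling.densityMatrices n,
      QuantumScaling.bridgeMap A α β U = U → U.PosDef) := by
  have hin : ∀ U ∈ QuantumScaling.densityMatrices n,
      QuantumScaling.scalingMap β (QuantumScaling.cpMap A U) ∈ QuantumScaling.densityMatrices n :=
    fun U hU => QuantumScaling.scalingMap_mem_densityMatrices hβ (hpos U hU)
  have hmaps : Set.MapsTo (QuantumScaling.bridgeMap A α β)
      (QuantumScaling.densityMatrices n) (QuantumScaling.densityMatrices n) := fun U hU =>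
    QuantumScaling.scalingMap_mem_densityMatrices hα (hpos.normalizedDual_posDef (hin U hU))
  have hcont : ContinuousOn (QuantumScaling.bridgeMap A α β)
      (QuantumScaling.densityMatrices n) :=
    (QuantumScaling.continuousOn_scalingMap hα).comp
      (hpos.continuousOn_normalizedDual.comp
        ((QuantumScaling.continuousOn_scalingMap hβ).comp
          (QuantumScaling.continuous_cpMap A).continuousOn hpos) hin)
      fun U hU => hpos.normalizedDual_posDef (hin U hU)
  refine ⟨hmaps, hcont, ?_, fun hαpos U hU hfix => ?_⟩
  · exact QuantumScaling.convex_densityMatrices.exists_fixedPoint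
      QuantumScaling.isCompact_densityMatrices ⟨α, hα⟩ hcont hmaps
  · rw [← hfix]
    exact QuantumScaling.scalingMap_posDef hα hαpos (hpos.normalizedDual_posDef (hin U hU))
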